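/- Let $n\ge 1$ and let $X=(X_1,\dots,X_n)$ be a random vector with real components on a probability space. Call a function $p:\mathbb{R}^n\to\mathbb{R}_+$ MTP$_2$ (multivariate totally positive of order 2) if $$p(x\wedge y)\,p(x\vee y)\ \ge\ p(x)\,p(y)\qquad\text{for all }x,y\in\mathbb{R}^n,$$ where $\wedge$ and $\vee$ denote the componentwise minimum and maximum. The random vector $X$ is called MTP$_2$ if there are $\sigma$-finite Borel measures $\mu_1,\dots,\mu_n$ on $\mathbb{R}$ such that the law of $X$ has a (Borel measurable) MTP$_2$ density with respect to $\mu_1\otimes\cdots\otimes\mu_n$. Theorem. Every MTP$_2$ random vector $X=(X_1,\dots,X_n)$ is strongly conditionally monotone, that is: for every $i\in\{1,\dots,n\}$, all continuous and strictly positive functions $f_1,\dots,f_n$ on $\mathbb{R}$ with $\mathbb{E}\big[\prod_{k=1}^n f_k(X_k)\big]<\infty$, and every bounded, continuous, componentwise non-decreasing function $\phi:\mathbb{R}^n\to\mathbb{R}$, the function $$z\longmapsto K_i(z)=\frac{\mathbb{E}\big[\phi(X_1,\dots,X_n)\prod_{k=1}^n f_k(X_k)\,\big|\,X_i=z\big]}{\mathbb{E}\big[\prod_{k=1}^n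 f_k(X_k)\,\big|\,X_i=z\big]}$$ is non-decreasing. Since the two conditional expectations, as functions of $z$, are determined only up to null sets of the law of $X_i$, this means: for any choice of Borel versions of the numerator and of the denominator, the denominator is strictly positive for almost every $z$, and the quotient coincides for almost every $z$ with a non-decreasing function $K_i:\mathbb{R}\to\mathbb{R}$, where ``almost every'' refers to the law of $X_i$. -/

import Mathlib

open MeasureTheory
open scoped NNReal ENNReal

/-- A function `p : ℝⁿ → ℝ₊` is multivariate totally positive of order 2; `⊓` and `⊔` are the
componentwise minimum and maximum. -/
def IsMTP2Fun {n : ℕ} (p : (Fin n → ℝ) → ℝ≥0) : Prop :=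
  ∀ x y : Fin n → ℝ, p x * p y ≤ p (x ⊓ y) * p (x ⊔ y)

/-- The random vector `X` is MTP₂: its law has, with respect to some product of σ-finite Borel
measures on `ℝ`, a (measurable) density which is an MTP₂ function. -/
def IsMTP2 {Ω : Type*} [MeasurableSpace Ω] (P : Measure Ω) {n : ℕ} (X : Ω → Fin n → ℝ) : Prop :=
  ∃ μ : Fin n → Measure ℝ, (∀ k, SigmaFinite (μ k)) ∧
    ∃ p : (Fin n → ℝ) → ℝ≥0, Measurable p ∧ IsMTP2Fun p ∧
      P.map X = (Measure.pi μ).withDensity (fun x => (p x : ℝ≥0∞))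

/-- `g` is a version of the function `z ↦ 𝔼[Y | Z = z]`: it is Borel and
`g(Z) = 𝔼[Y | σ(Z)]` almost surely. -/
def IsCondExpGiven {Ω : Type*} [MeasurableSpace Ω] (P : Measure Ω) (Y Z : Ω → ℝ) (g : ℝ → ℝ) :
    Prop :=
  Measurable g ∧
    (fun ω => g (Z ω)) =ᵐ[P] P[Y | MeasurableSpace.comap Z inferInstance]

/-- Versions of `z ↦ 𝔼[Y | Z = z]` exist. -/
theorem exists_isCondExpGiven {Ω : Type*} [MeasurableSpace Ω] (P : Measure Ω) (Y Z : Ω → ℝ) :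
    ∃ g : ℝ → ℝ, IsCondExpGiven P Y Z g := by
  have h : Measurable[MeasurableSpace.comap Z inferInstance]
      (P[Y | MeasurableSpace.comap Z inferInstance]) := stronglyMeasurable_condExp.measurable
  obtain ⟨g, hg, hgY⟩ := h.exists_eq_measurable_comp
  exact ⟨g, hg, Filter.EventuallyEq.of_eq hgY.symm⟩

/-- The set `𝓘ₙ` of continuous, bounded, componentwise non-decreasing functions on `ℝⁿ`. -/
def IncrFun (n : ℕ) : Set ((Fin n → ℝ) → ℝ) :=
  {φ | Continuous φ ∧ (∃ C : ℝ, ∀ x, |φ x| ≤ C) ∧ Monotone φ}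

/-- Strong conditional monotonicity. Conditional expectations given `X_i = z` are functions of `z`
determined up to null sets of the law of `X_i`, so, whichever versions `N` of the numerator and `D`
of the denominator are taken, the statement is that `D > 0` almost everywhere and that `N / D`
agrees almost everywhere with a non-decreasing function `K_i` on `ℝ`. -/
def IsSCM {Ω : Type*} [MeasurableSpace Ω] (P : Measure Ω) {n : ℕ} (X : Ω → Fin n → ℝ) : Prop :=
  ∀ (i : Fin n) (f : Fin n → ℝ → ℝ), (∀ k, Continuous (f k)) → (∀ k x, 0 < f k x) →
    Integrable (fun ω => ∏ k, f k (X ω k)) P →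
    ∀ φ ∈ IncrFun n, ∀ N D : ℝ → ℝ,
      IsCondExpGiven P (fun ω => φ (X ω) * ∏ k, f k (X ω k)) (fun ω => X ω i) N →
      IsCondExpGiven P (fun ω => ∏ k, f k (X ω k)) (fun ω => X ω i) D →
      (∀ᵐ z ∂(P.map (fun ω => X ω i)), 0 < D z) ∧
        ∃ K : ℝ → ℝ, Monotone K ∧
          ∀ᵐ z ∂(P.map (fun ω => X ω i)), N z / D z = K z

/-! Multiplying an MTP₂ density `p` by `∏ f_k(x_k)` keeps it MTP₂; call the result `q`. After
shifting `φ` to some `ψ ≥ 0`, the conditional quotient is a ratio of integrals of `ψ q` and `q` over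
the fibre `x_i = z`. Its monotonicity is the cross inequality of `fiberLIntegral_mul_le`, an
instance of the four functions theorem, which follows by induction on the dimension from the case of
a linear order. A monotone `K` representing the ratio is then recognised as the conditional quotient
by testing against events in `σ(X_i)`. -/

theorem ENNReal.add_le_add_of_mul_le_mul {a b c d : ℝ≥0∞} (hac : a ≤ c) (hbc : b ≤ c)
    (h : a * b ≤ c * d) : a + b ≤ c + d := by
  rcases eq_or_ne c ∞ with rfl | hc
  · simp
  rcases eq_or_ne d ∞ with rfl | hd
  · simp
  lift c to ℝ≥0 using hc
  lift d to ℝ≥0 using hd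
  lift a to ℝ≥0 using ne_top_of_le_ne_top ENNReal.coe_ne_top hac
  lift b to ℝ≥0 using ne_top_of_le_ne_top ENNReal.coe_ne_top hbc
  norm_cast at *
  rcases eq_or_ne c 0 with rfl | hc
  · simp_all
  have hc' : 0 < (c : ℝ) := by exact_mod_cast pos_iff_ne_zero.2 hc
  have h1 : (a : ℝ) ≤ c := by exact_mod_cast hac
  have h2 : (b : ℝ) ≤ c := by exact_mod_cast hbc
  have h3 : (a : ℝ) * b ≤ c * d := by exact_mod_cast h
  -- From `(c - a)(c - b) ≥ 0` and `ab ≤ cd`: `c(a + b) ≤ c² + ab ≤ c(c + d)`; cancel `c > 0`.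
  have : (a : ℝ) + b ≤ c + d := by
    nlinarith [mul_nonneg (sub_nonneg.2 h1) (sub_nonneg.2 h2)]
  exact_mod_cast this

/-- The four functions theorem for a σ-finite measure on a linear order. -/
theorem lintegral_mul_lintegral_le_of_linearOrder {α : Type*} [LinearOrder α] [MeasurableSpace α]
    {μ : Measure α} [SigmaFinite μ] {f₁ f₂ f₃ f₄ : α → ℝ≥0∞}
    (h₁ : Measurable f₁) (h₂ : Measurable f₂) (h₃ : Measurable f₃) (h₄ : Measurable f₄)
    (h : ∀ x y, f₁ x * f₂ y ≤ f₃ (x ⊓ y) * f₄ (x ⊔ y)) :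
    (∫⁻ x, f₁ x ∂μ) * ∫⁻ x, f₂ x ∂μ ≤ (∫⁻ x, f₃ x ∂μ) * ∫⁻ x, f₄ x ∂μ := by
  -- Symmetrizing over the square reduces the claim to a pointwise inequality at ordered pairs `x ≤
  -- y`.
  have key : ∀ f g : α → ℝ≥0∞, Measurable f → Measurable g →
      ∫⁻ z, (f z.1 * g z.2 + g z.1 * f z.2) ∂(μ.prod μ)
        = 2 * ((∫⁻ x, f x ∂μ) * ∫⁻ x, g x ∂μ) := by
    intro f g hf hg
    rw [lintegral_add_left (by fun_prop), lintegral_prod_mul hf.aemeasurable hg.aemeasurable,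
      lintegral_prod_mul hg.aemeasurable hf.aemeasurable, two_mul]
    congr 1
    exact mul_comm _ _
  have main : ∀ x y, x ≤ y → f₁ x * f₂ y + f₂ x * f₁ y ≤ f₃ x * f₄ y + f₄ x * f₃ y := by
    intro x y hxy
    -- The dominating term is `f₃ x * f₄ y`, by the hypothesis at `(x, y)` and `(y, x)`; the product
    -- bound comes from the diagonal pairs.
    refine ENNReal.add_le_add_of_mul_le_mul ?_ ?_ ?_
    · simpa [hxy] using h x y
    · simpa [hxy, mul_comm] using h y x
    · have hx := h x x
      have hy := h y y
      simp only [inf_idem, sup_idem] at hx hy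
      calc f₁ x * f₂ y * (f₂ x * f₁ y) = (f₁ x * f₂ x) * (f₁ y * f₂ y) := by ring
        _ ≤ (f₃ x * f₄ x) * (f₃ y * f₄ y) := mul_le_mul' hx hy
        _ = f₃ x * f₄ y * (f₄ x * f₃ y) := by ring
  have h2 : 2 * ((∫⁻ x, f₁ x ∂μ) * ∫⁻ x, f₂ x ∂μ) ≤ 2 * ((∫⁻ x, f₃ x ∂μ) * ∫⁻ x, f₄ x ∂μ) := by
    rw [← key f₁ f₂ h₁ h₂, ← key f₃ f₄ h₃ h₄]
    refine lintegral_mono fun z => ?_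
    rcases le_total z.1 z.2 with hz | hz
    · exact main _ _ hz
    · have := main _ _ hz
      simp only [mul_comm (f₁ z.2), mul_comm (f₂ z.2), mul_comm (f₃ z.2), mul_comm (f₄ z.2)] at this
      rwa [add_comm (f₂ z.1 * f₁ z.2), add_comm (f₄ z.1 * f₃ z.2)] at this
  exact (ENNReal.mul_le_mul_iff_right (by simp) (by simp)).1 h2

/-! ### Fibre integrals and the four functions theorem on products -/

theorem Fin.insertNth_inf_insertNth {n : ℕ} (i : Fin (n + 1)) (a b : ℝ) (x y : Fin n → ℝ) :
    (i.insertNth a x : Fin (n + 1) → ℝ) ⊓ i.insertNth b y = i.insertNth (a ⊓ b) (x ⊓ y) :=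
  (Fin.insertNth_binop (α := fun _ => ℝ) (fun _ => (· ⊓ ·)) i a b x y).symm

theorem Fin.insertNth_sup_insertNth {n : ℕ} (i : Fin (n + 1)) (a b : ℝ) (x y : Fin n → ℝ) :
    (i.insertNth a x : Fin (n + 1) → ℝ) ⊔ i.insertNth b y = i.insertNth (a ⊔ b) (x ⊔ y) :=
  (Fin.insertNth_binop (α := fun _ => ℝ) (fun _ => (· ⊔ ·)) i a b x y).symm

theorem measurable_insertNth_prod {n : ℕ} (i : Fin (n + 1)) :
    Measurable fun z : ℝ × (Fin n → ℝ) => (i.insertNth z.1 z.2 : Fin (n + 1) → ℝ) :=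
  (MeasurableEquiv.piFinSuccAbove (fun _ => ℝ) i).symm.measurable

/-- The integral of `g` over all coordinates but the `i`-th, which is set to `z`. -/
noncomputable def fiberLIntegral {n : ℕ} (μ : Fin (n + 1) → Measure ℝ) (i : Fin (n + 1))
    (g : (Fin (n + 1) → ℝ) → ℝ≥0∞) (z : ℝ) : ℝ≥0∞ :=
  ∫⁻ y, g (i.insertNth z y) ∂Measure.pi fun j => μ (i.succAbove j)

section fiber

variable {n : ℕ} {μ : Fin (n + 1) → Measure ℝ} [∀ k, SigmaFinite (μ k)] (i : Fin (n + 1))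
  {g : (Fin (n + 1) → ℝ) → ℝ≥0∞}

theorem measurable_fiberLIntegral (hg : Measurable g) : Measurable (fiberLIntegral μ i g) :=
  (hg.comp (measurable_insertNth_prod i)).lintegral_prod_right'

theorem lintegral_fiberLIntegral (hg : Measurable g) :
    ∫⁻ z, fiberLIntegral μ i g z ∂μ i = ∫⁻ x, g x ∂Measure.pi μ := by
  rw [← ((measurePreserving_piFinSuccAbove μ i).symm).lintegral_comp hg]
  exact (lintegral_prod _ (hg.comp (measurable_insertNth_prod i)).aemeasurable).symm

end fiber

/-- The four functions theorem for products of σ-finite measures on `ℝ`. -/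
theorem lintegral_pi_mul_lintegral_pi_le {n : ℕ} (μ : Fin n → Measure ℝ) [∀ k, SigmaFinite (μ k)]
    {f₁ f₂ f₃ f₄ : (Fin n → ℝ) → ℝ≥0∞}
    (h₁ : Measurable f₁) (h₂ : Measurable f₂) (h₃ : Measurable f₃) (h₄ : Measurable f₄)
    (h : ∀ x y, f₁ x * f₂ y ≤ f₃ (x ⊓ y) * f₄ (x ⊔ y)) :
    (∫⁻ x, f₁ x ∂Measure.pi μ) * ∫⁻ x, f₂ x ∂Measure.pi μ
      ≤ (∫⁻ x, f₃ x ∂Measure.pi μ) * ∫⁻ x, f₄ x ∂Measure.pi μ := by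
  induction n with
  | zero =>
    rw [Measure.pi_of_empty]
    simp only [lintegral_dirac]
    simpa [Subsingleton.elim _ (isEmptyElim : Fin 0 → ℝ)] using h isEmptyElim isEmptyElim
  | succ n ih =>
    rw [← lintegral_fiberLIntegral 0 h₁, ← lintegral_fiberLIntegral 0 h₂,
      ← lintegral_fiberLIntegral 0 h₃, ← lintegral_fiberLIntegral 0 h₄]
    refine lintegral_mul_lintegral_le_of_linearOrder (measurable_fiberLIntegral 0 h₁)
      (measurable_fiberLIntegral 0 h₂) (measurable_fiberLIntegral 0 h₃)
      (measurable_fiberLIntegral 0 h₄) fun a b => ?_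
    have hm (c : ℝ) := (measurable_insertNth_prod (0 : Fin (n + 1))).comp
      (measurable_prodMk_left (x := c))
    -- The sections at `a`, `b`, `a ⊓ b`, `a ⊔ b` satisfy the hypothesis in one dimension less, so
    -- the fibre integrals satisfy it on `ℝ`.
    refine ih _ (h₁.comp (hm a)) (h₂.comp (hm b)) (h₃.comp (hm _)) (h₄.comp (hm _)) fun x y => ?_
    have := h (Fin.insertNth 0 a x) (Fin.insertNth 0 b y)
    rwa [Fin.insertNth_inf_insertNth, Fin.insertNth_sup_insertNth] at this

/-- Fiber integrals against an MTP₂ weight satisfy the monotone ratio inequality. -/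
theorem fiberLIntegral_mul_le {n : ℕ} (μ : Fin (n + 1) → Measure ℝ) [∀ k, SigmaFinite (μ k)]
    (i : Fin (n + 1)) {q ψ : (Fin (n + 1) → ℝ) → ℝ≥0∞} (hq : Measurable q) (hψ : Measurable ψ)
    (hψm : Monotone ψ) (h : ∀ x y, q x * q y ≤ q (x ⊓ y) * q (x ⊔ y)) {z w : ℝ} (hzw : z ≤ w) :
    fiberLIntegral μ i (fun x => ψ x * q x) z * fiberLIntegral μ i q w
      ≤ fiberLIntegral μ i q z * fiberLIntegral μ i (fun x => ψ x * q x) w := by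
  have hm (c : ℝ) := (measurable_insertNth_prod i).comp (measurable_prodMk_left (x := c))
  -- The four functions are the sections of `ψ q` at `z`, `q` at `w`, `q` at `z` and `ψ q` at `w`;
  -- monotonicity moves `ψ` up to the join.
  refine lintegral_pi_mul_lintegral_pi_le _ ((hψ.mul hq).comp (hm z)) (hq.comp (hm w))
    (hq.comp (hm z)) ((hψ.mul hq).comp (hm w)) fun x y => ?_
  have hxy := h (i.insertNth z x) (i.insertNth w y)
  have hle := hψm (le_sup_left (a := (i.insertNth z x : Fin (n + 1) → ℝ)) (b := i.insertNth w y))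
  rw [Fin.insertNth_inf_insertNth, Fin.insertNth_sup_insertNth, inf_eq_left.2 hzw,
    sup_eq_right.2 hzw] at hxy
  rw [Fin.insertNth_sup_insertNth, sup_eq_right.2 hzw] at hle
  calc _ = ψ (i.insertNth z x) * (q (i.insertNth z x) * q (i.insertNth w y)) := mul_assoc _ _ _
    _ ≤ _ := mul_le_mul' hle hxy
    _ = _ := mul_left_comm _ _ _

/-! ### Monotone quotients and conditional expectations -/

/-- Where `0 < D < ∞` the quotient is bounded and non-decreasing, so it extends to `ℝ`. The product
form of the conclusion also covers `D = 0`, where `N = 0` by domination. -/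
theorem exists_monotone_ratio {m : Measure ℝ} {N D : ℝ → ℝ≥0∞} {B : ℝ≥0}
    (hNB : ∀ z, N z ≤ B * D z) (hD : ∀ᵐ z ∂m, D z ≠ ∞)
    (h : ∀ z w, z ≤ w → N z * D w ≤ D z * N w) :
    ∃ K : ℝ → ℝ, Monotone K ∧ (∀ z, 0 ≤ K z) ∧ (∀ z, K z ≤ B) ∧
      ∀ᵐ z ∂m, N z = ENNReal.ofReal (K z) * D z := by
  set S : Set ℝ := {z | D z ≠ 0 ∧ D z ≠ ∞}
  have hle : ∀ z ∈ S, N z / D z ≤ B := fun z hz =>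
    (ENNReal.div_le_iff hz.1 hz.2).2 (hNB z)
  have hle' : ∀ z ∈ S, (N z / D z).toReal ≤ B := fun z hz => by
    simpa using ENNReal.toReal_mono ENNReal.coe_ne_top (hle z hz)
  have hmono : MonotoneOn (fun z => (N z / D z).toReal) S := by
    intro z hz w hw hzw
    refine ENNReal.toReal_mono (ne_top_of_le_ne_top ENNReal.coe_ne_top (hle w hw)) ?_
    rw [ENNReal.div_le_iff hz.1 hz.2, ENNReal.div_eq_inv_mul, mul_assoc,
      ← ENNReal.div_eq_inv_mul, ENNReal.le_div_iff_mul_le (Or.inl hw.1) (Or.inl hw.2),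
      mul_comm (N w)]
    exact h z w hzw
  obtain ⟨g, hg, hgS⟩ := hmono.exists_monotone_extension
    ⟨0, by rintro _ ⟨z, -, rfl⟩; exact ENNReal.toReal_nonneg⟩
    ⟨B, by rintro _ ⟨z, hz, rfl⟩; exact hle' z hz⟩
  -- Truncation to `[0, B]` changes nothing on `S` and makes the bounds hold everywhere.
  refine ⟨fun z => max 0 (min (g z) B), fun z w hzw => ?_, fun z => le_max_left _ _,
    fun z => max_le B.2 (min_le_right _ _), ?_⟩
  · exact max_le_max le_rfl (min_le_min (hg hzw) le_rfl)
  · filter_upwards [hD] with z hz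
    by_cases h0 : D z = 0
    · have := hNB z
      simp_all
    · have hzS : z ∈ S := ⟨h0, hz⟩
      have hgz : g z = (N z / D z).toReal := (hgS hzS).symm
      rw [hgz, min_eq_left (hle' z hzS), max_eq_right ENNReal.toReal_nonneg,
        ENNReal.ofReal_toReal (ne_top_of_le_ne_top ENNReal.coe_ne_top (hle z hzS)),
        ENNReal.div_mul_cancel h0 hz]

theorem setLIntegral_preimage_eq_fiberLIntegral {Ω : Type*} [MeasurableSpace Ω] {P : Measure Ω}
    {n : ℕ} {X : Ω → Fin (n + 1) → ℝ} (hX : Measurable X) {μ : Fin (n + 1) → Measure ℝ}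
    [∀ k, SigmaFinite (μ k)] {p : (Fin (n + 1) → ℝ) → ℝ≥0∞} (hp : Measurable p)
    (hPX : P.map X = (Measure.pi μ).withDensity p) (i : Fin (n + 1))
    {g : (Fin (n + 1) → ℝ) → ℝ≥0∞} (hg : Measurable g) {A : Set ℝ} (hA : MeasurableSet A) :
    ∫⁻ ω in (fun ω => X ω i) ⁻¹' A, g (X ω) ∂P
      = ∫⁻ z in A, fiberLIntegral μ i (fun x => g x * p x) z ∂μ i := by
  have hA' : MeasurableSet ((fun x : Fin (n + 1) → ℝ => x i) ⁻¹' A) := measurable_pi_apply i hA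
  have hpre : (fun ω => X ω i) ⁻¹' A = X ⁻¹' ((fun x => x i) ⁻¹' A) := rfl
  rw [hpre, ← setLIntegral_map hA' hg hX, hPX, ← lintegral_indicator hA',
    lintegral_withDensity_eq_lintegral_mul _ hp (hg.indicator hA'),
    ← lintegral_fiberLIntegral i (hp.mul (hg.indicator hA')), ← lintegral_indicator hA]
  congr 1 with z
  by_cases hz : z ∈ A <;> simp [fiberLIntegral, hz, Set.indicator, mul_comm]

/-- In each coordinate the minimum and maximum are the two original values, so the product weight
satisfies the MTP₂ relation with equality. -/
theorem IsMTP2Fun.mul_prod {n : ℕ} {p : (Fin n → ℝ) → ℝ≥0} (hp : IsMTP2Fun p)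
    (f : Fin n → ℝ → ℝ≥0) : IsMTP2Fun fun x => (∏ k, f k (x k)) * p x := by
  intro x y
  have hf : (∏ k, f k (x k)) * ∏ k, f k (y k)
      = (∏ k, f k ((x ⊓ y) k)) * ∏ k, f k ((x ⊔ y) k) := by
    simp_rw [← Finset.prod_mul_distrib]
    refine Finset.prod_congr rfl fun k _ => ?_
    rcases le_total (x k) (y k) with h | h <;> simp [h, mul_comm]
  calc _ = ((∏ k, f k (x k)) * ∏ k, f k (y k)) * (p x * p y) := by ring
    _ ≤ ((∏ k, f k ((x ⊓ y) k)) * ∏ k, f k ((x ⊔ y) k)) * (p (x ⊓ y) * p (x ⊔ y)) := by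
      rw [hf]; exact mul_le_mul_right (hp x y) _
    _ = _ := by ring

/-- Conditional expectations of positive functions are positive. -/
theorem IsCondExpGiven.ae_pos {Ω : Type*} [MeasurableSpace Ω] {P : Measure Ω} [IsFiniteMeasure P]
    {Y Z : Ω → ℝ} (hZ : Measurable Z) (hY : Integrable Y P) (hpos : ∀ ω, 0 < Y ω) {D : ℝ → ℝ}
    (hD : IsCondExpGiven P Y Z D) : ∀ᵐ z ∂P.map Z, 0 < D z := by
  have hset : MeasurableSet {z | 0 < D z} := measurableSet_lt measurable_const hD.1
  rw [ae_map_iff hZ.aemeasurable hset]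
  -- On the event `D(Z) ≤ 0`, which lies in `σ(Z)`, the integrals of `D(Z)` and `Y` agree; the first
  -- is at most `0`, the second positive unless the event is null.
  have hs : MeasurableSet[MeasurableSpace.comap Z inferInstance] (Z ⁻¹' {z | 0 < D z}ᶜ) :=
    ⟨_, hset.compl, rfl⟩
  have hsm : MeasurableSet (Z ⁻¹' {z | 0 < D z}ᶜ) := hZ hset.compl
  have h1 := setIntegral_condExp hZ.comap_le hY hs
  have h2 : ∫ ω in Z ⁻¹' {z | 0 < D z}ᶜ, D (Z ω) ∂P = ∫ ω in Z ⁻¹' {z | 0 < D z}ᶜ, Y ω ∂P := by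
    rw [← h1]
    exact setIntegral_congr_ae hsm (hD.2.mono fun ω h _ => h)
  have h3 : ∫ ω in Z ⁻¹' {z | 0 < D z}ᶜ, D (Z ω) ∂P ≤ 0 :=
    setIntegral_nonpos hsm fun ω hω => not_lt.1 hω
  by_contra hne
  have h4 : 0 < ∫ ω in Z ⁻¹' {z | 0 < D z}ᶜ, Y ω ∂P := by
    rw [integral_pos_iff_support_of_nonneg (fun ω => (hpos ω).le) hY.integrableOn]
    have : Function.support Y = Set.univ := by
      ext ω; simpa using (hpos ω).ne'
    rw [this, Measure.restrict_apply_univ]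
    exact pos_iff_ne_zero.2 hne
  linarith

/-- Every MTP₂ random vector is strongly conditionally monotone. -/
theorem mainTheorem1 {Ω : Type*} [MeasurableSpace Ω] (P : Measure Ω) [IsProbabilityMeasure P]
    (n : ℕ) (X : Ω → Fin n → ℝ) (hX : Measurable X) (hMTP : IsMTP2 P X) :
    IsSCM P X := by
  intro i f hfc hfpos hint φ hφ N D hN hD
  obtain ⟨hφc, ⟨C, hC⟩, hφm⟩ := hφ
  obtain ⟨μ, hμ, p, hp, hpMTP, hPX⟩ := hMTP
  have hXi : Measurable fun ω => X ω i := (measurable_pi_apply i).comp hX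
  have hDpos := hD.ae_pos hXi hint fun ω => Finset.prod_pos fun k _ => hfpos k _
  refine ⟨hDpos, ?_⟩
  obtain _ | n := n
  · exact i.elim0
  have hC0 : 0 ≤ C := (abs_nonneg _).trans (hC 0)
  set F : (Fin (n + 1) → ℝ) → ℝ := fun x => ∏ k, f k (x k)
  have hFc : Continuous F := continuous_finsetProd _ fun k _ => (hfc k).comp (continuous_apply k)
  have hFpos : ∀ x, 0 < F x := fun x => Finset.prod_pos fun k _ => hfpos k _
  have hintF : Integrable (fun ω => F (X ω)) P := hint
  let F' : (Fin (n + 1) → ℝ) → ℝ≥0∞ := fun x => ENNReal.ofReal (F x)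
  have hF' : Measurable F' := hFc.measurable.ennreal_ofReal
  let q : (Fin (n + 1) → ℝ) → ℝ≥0∞ := fun x => F' x * p x
  have hq : Measurable q := hF'.mul hp.coe_nnreal_ennreal
  have hqMTP : ∀ x y, q x * q y ≤ q (x ⊓ y) * q (x ⊔ y) := by
    have hqe : ∀ x, q x = (((∏ k, (f k (x k)).toNNReal) * p x : ℝ≥0) : ℝ≥0∞) := fun x => by
      have : F' x = ((∏ k, (f k (x k)).toNNReal : ℝ≥0) : ℝ≥0∞) := by
        rw [← Real.toNNReal_prod_of_nonneg fun k _ => (hfpos k _).le]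
        rfl
      rw [ENNReal.coe_mul, ← this]
    intro x y
    simp only [hqe]
    exact_mod_cast hpMTP.mul_prod (fun k t => (f k t).toNNReal) x y
  -- As `|φ| ≤ C`, the shifted function takes values in `[0, 2C]`, whence the bound `2C` on `K`; the
  -- shift is undone by `K - C`.
  let ψ : (Fin (n + 1) → ℝ) → ℝ≥0∞ := fun x => ENNReal.ofReal (φ x + C)
  have hψ : Measurable ψ := (hφc.measurable.add_const C).ennreal_ofReal
  have hψm : Monotone ψ := fun x y hxy => ENNReal.ofReal_le_ofReal (by linarith [hφm hxy])
  have hfib := fun {g : (Fin (n + 1) → ℝ) → ℝ≥0∞} (hg : Measurable g) {A : Set ℝ}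
    (hA : MeasurableSet A) => setLIntegral_preimage_eq_fiberLIntegral hX hp.coe_nnreal_ennreal hPX
      i hg hA
  have hdfin : ∀ᵐ z ∂μ i, fiberLIntegral μ i q z ≠ ∞ := by
    have h1 := hfib hF' MeasurableSet.univ
    simp only [Set.preimage_univ, Measure.restrict_univ] at h1
    have h2 : ∫⁻ z, fiberLIntegral μ i q z ∂μ i ≠ ∞ := by
      rw [← h1]
      exact hintF.lintegral_lt_top.ne
    filter_upwards [ae_lt_top (measurable_fiberLIntegral i hq) h2] with z hz using hz.ne
  obtain ⟨K, hKm, hK0, hKB, hK⟩ := exists_monotone_ratio (m := μ i)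
    (N := fiberLIntegral μ i fun x => ψ x * q x) (D := fiberLIntegral μ i q)
    (B := (2 * C).toNNReal) (fun z => by
      have hm := (measurable_insertNth_prod i).comp (measurable_prodMk_left (x := z))
      refine le_trans ?_ (lintegral_const_mul _ (hq.comp hm)).le
      refine lintegral_mono fun y => mul_le_mul_left (ENNReal.ofReal_le_ofReal ?_) _
      linarith [(abs_le.1 (hC (i.insertNth z y))).2])
    hdfin (fun z w hzw => fiberLIntegral_mul_le μ i hq hψ hψm hqMTP hzw)
  rw [Real.coe_toNNReal _ (by positivity)] at hKB
  refine ⟨fun z => K z - C, fun z w h => sub_le_sub_right (hKm h) C, ?_⟩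
  have hKmeas : Measurable K := hKm.measurable
  have hint1 : Integrable (fun ω => φ (X ω) * F (X ω)) P :=
    hintF.bdd_mul (hφc.measurable.comp hX).aestronglyMeasurable (c := C)
      (Filter.Eventually.of_forall fun ω => hC _)
  have hint2 : Integrable (fun ω => (K (X ω i) - C) * F (X ω)) P := by
    refine hintF.bdd_mul ((hKmeas.comp hXi).sub_const C).aestronglyMeasurable (c := C)
      (Filter.Eventually.of_forall fun ω => ?_)
    rw [Real.norm_eq_abs, abs_le]
    constructor <;> linarith [hK0 (X ω i), hKB (X ω i)]
  have hset : ∀ A : Set ℝ, MeasurableSet A →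
      ∫ ω in (fun ω => X ω i) ⁻¹' A, φ (X ω) * F (X ω) ∂P
        = ∫ ω in (fun ω => X ω i) ⁻¹' A, (K (X ω i) - C) * F (X ω) ∂P := by
    intro A hA
    have hKm' : Measurable fun x : Fin (n + 1) → ℝ => ENNReal.ofReal (K (x i)) :=
      (hKmeas.comp (measurable_pi_apply i)).ennreal_ofReal
    have hl : ∫⁻ ω in (fun ω => X ω i) ⁻¹' A, ENNReal.ofReal ((φ (X ω) + C) * F (X ω)) ∂P
        = ∫⁻ ω in (fun ω => X ω i) ⁻¹' A, ENNReal.ofReal (K (X ω i) * F (X ω)) ∂P := by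
      simp only [ENNReal.ofReal_mul' (hFpos _).le]
      refine (hfib (hψ.mul hF') hA).trans (Eq.trans ?_ (hfib (hKm'.mul hF') hA).symm)
      -- `K (x i)` is constant on each fibre and factors out of the fibre integral.
      refine lintegral_congr_ae (ae_restrict_of_ae ?_)
      filter_upwards [hK] with z hz
      have hm := (measurable_insertNth_prod i).comp (measurable_prodMk_left (x := z))
      simp only [Pi.mul_apply, mul_assoc]
      rw [hz]
      simp only [fiberLIntegral, Fin.insertNth_apply_same]
      exact (lintegral_const_mul _ (hq.comp hm)).symm
    have hr : ∫ ω in (fun ω => X ω i) ⁻¹' A, (φ (X ω) + C) * F (X ω) ∂P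
        = ∫ ω in (fun ω => X ω i) ⁻¹' A, K (X ω i) * F (X ω) ∂P := by
      have hmF := hFc.measurable.comp hX
      rw [integral_eq_lintegral_of_nonneg_ae, integral_eq_lintegral_of_nonneg_ae, hl]
      · exact Filter.Eventually.of_forall fun ω => mul_nonneg (hK0 _) (hFpos _).le
      · exact ((hKmeas.comp hXi).mul hmF).aestronglyMeasurable
      · exact Filter.Eventually.of_forall fun ω =>
          mul_nonneg (by linarith [(abs_le.1 (hC (X ω))).1]) (hFpos _).le
      · exact (((hφc.measurable.comp hX).add_const C).mul hmF).aestronglyMeasurable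
    have e1 : ∀ ω, φ (X ω) * F (X ω) = (φ (X ω) + C) * F (X ω) - C * F (X ω) := fun ω => by ring
    have hintC := hintF.const_mul C
    have hi1 : Integrable (fun ω => (φ (X ω) + C) * F (X ω)) P := by
      simp only [add_mul]
      exact hint1.add hintC
    have hi2 : Integrable (fun ω => K (X ω i) * F (X ω)) P := by
      refine (hint2.add hintC).congr (Filter.Eventually.of_forall fun ω => ?_)
      simp only [Pi.add_apply]
      ring
    simp only [e1, sub_mul]
    rw [integral_sub hi1.integrableOn hintC.integrableOn, hr,
      integral_sub hi2.integrableOn hintC.integrableOn]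
  have hle := hXi.comap_le
  have hce : P[fun ω => φ (X ω) * F (X ω) | MeasurableSpace.comap (fun ω => X ω i) inferInstance]
      =ᵐ[P] P[fun ω => (K (X ω i) - C) * F (X ω) |
        MeasurableSpace.comap (fun ω => X ω i) inferInstance] := by
    refine ae_eq_condExp_of_forall_setIntegral_eq hle hint2
      (fun s _ _ => integrable_condExp.integrableOn) (fun s hs _ => ?_)
      stronglyMeasurable_condExp.aestronglyMeasurable
    rw [setIntegral_condExp hle hint1 hs]
    obtain ⟨A, hA, rfl⟩ := hs
    exact hset A hA
  have hKsm : StronglyMeasurable[MeasurableSpace.comap (fun ω => X ω i) inferInstance]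
      fun ω => K (X ω i) - C :=
    ((hKmeas.sub_const C).comp (comap_measurable fun ω => X ω i)).stronglyMeasurable
  -- The factor `K(X_i) - C` is `σ(X_i)`-measurable, so it leaves the conditional expectation and
  -- the quotient reduces to it.
  have hpull := condExp_mul_of_stronglyMeasurable_left hKsm hint2 hintF
  have hratio : MeasurableSet {z | N z / D z = K z - C} :=
    measurableSet_eq_fun (hN.1.div hD.1) (hKmeas.sub_const C)
  rw [ae_map_iff hXi.aemeasurable hratio]
  filter_upwards [hN.2, hD.2, hce, hpull, ae_of_ae_map hXi.aemeasurable hDpos]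
    with ω h1 h2 h3 h4 h5
  rw [div_eq_iff h5.ne', h1, h2]
  exact h3.trans h4
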